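/- **Cut elimination for the calculi $LS_G$.** *Syntax.* Fix a set of propositional variables and an infinite set $V$ of label variables; a label is an element of $V$ or the constant $\epsilon\notin V$. Formulae are $A ::= p \mid \top \mid \bot \mid \top^* \mid A\wedge A \mid A\to A \mid A * A \mid A \mathbin{-\!*} A$. Relational atoms are $x=y$, $x\neq y$ and $(x,y\rhd z)$ for labels $x,y,z$. A sequent $\mathcal G;\Gamma\vdash\Delta$ consists of a finite set $\mathcal G$ of relational atoms and finite sets $\Gamma,\Delta$ of labelled formulae $w:A$; the symbol ";" denotes union. $E(\mathcal G)\vdash x=y$ means that $(x,y)$ lies in the least equivalence relation on labels containing all pairs $(a,b)$ with $(a=b)\in\mathcal G$. *Frame axioms.* A frame axiom has the form $$\forall x_1,\dots,x_m.\ \big(s_1=t_1 \,\&\cdots\&\, s_p=t_p \,\&\, S_1\,\&\cdots\&\, S_k \ \Rightarrow\ \exists y_1,\dots,y_n.\ (T_1\,\&\cdots\&\, T_l)\big)$$ with $m,n,p,k,l\ge 0$, where $s_i,t_i\in\{x_1,\dots,x_m,\epsilon\}$; each $S_i$ is an inequality or a ternary atom over $x_1,\dots,x_m,\epsilon$; $\epsilon$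 does not occur in a ternary $S_i$; every variable occurs at most once in $S_1,\dots,S_k$; and each $T_i$ is a relational atom over $x_1,\dots,x_m,y_1,\dots,y_n,\epsilon$. *Calculus.* Given a set $\mathcal{F}r$ of frame axioms, the corresponding instance of $LS_G$ has the following rules (premises / conclusion). - $id$: $\mathcal G;\Gamma;w:p\vdash w':p;\Delta$ if $E(\mathcal G)\vdash w=w'$ ($p$ a propositional variable). $\bot L$: $\mathcal G;\Gamma;w:\bot\vdash\Delta$. $\top R$: $\mathcal G;\Gamma\vdash w:\top;\Delta$. $\top^*R$: $\mathcal G;\Gamma\vdash w:\top^*;\Delta$ if $E(\mathcal G)\vdash w=\epsilon$. - $\top^*L$: $\mathcal G;w=\epsilon;\Gamma\vdash\Delta$ / $\mathcal G;\Gamma;w:\top^*\vdash\Delta$. - $\wedge L$: $\mathcal G;\Gamma;w:A;w:B\vdash\Delta$ / $\mathcal G;\Gamma;w:A\wedge B\vdash\Delta$. $\wedge R$: $\mathcal G;\Gamma\vdash w:A;\Delta$ and $\mathcal G;\Gamma\vdash w:B;\Delta$ / $\mathcal G;\Gamma\vdash w:A\wedge B;\Delta$. - ${\to}L$: $\mathcal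 G;\Gamma\vdash w:A;\Delta$ and $\mathcal G;\Gamma;w:B\vdash\Delta$ / $\mathcal G;\Gamma;w:A\to B\vdash\Delta$. ${\to}R$: $\mathcal G;\Gamma;w:A\vdash w:B;\Delta$ / $\mathcal G;\Gamma\vdash w:A\to B;\Delta$. - $*L$: $\mathcal G;(x,y\rhd z);\Gamma;x:A;y:B\vdash\Delta$ / $\mathcal G;\Gamma;z:A*B\vdash\Delta$, with $x,y$ distinct label variables not occurring in the conclusion. - ${-\!*}R$: $\mathcal G;(x,z\rhd y);\Gamma;x:A\vdash y:B;\Delta$ / $\mathcal G;\Gamma\vdash z:A\mathbin{-\!*}B;\Delta$, with $x,y$ distinct label variables not occurring in the conclusion. - $*R$: if $(x,y\rhd z)\in\mathcal G$ and $E(\mathcal G)\vdash z=z'$: $\mathcal G;\Gamma\vdash x:A;z':A*B;\Delta$ and $\mathcal G;\Gamma\vdash y:B;z':A*B;\Delta$ / $\mathcal G;\Gamma\vdash z':A*B;\Delta$. - ${-\!*}L$: if $(x,y\rhd z)\in\mathcal G$ and $E(\mathcal G)\vdash y=y'$: $\mathcal G;\Gamma;y':A\mathbin{-\!*}B\vdash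 x:A;\Delta$ and $\mathcal G;\Gamma;y':A\mathbin{-\!*}B;z:B\vdash\Delta$ / $\mathcal G;\Gamma;y':A\mathbin{-\!*}B\vdash\Delta$. - $NEq$: $\mathcal G;\Gamma\vdash\Delta$ if $(x\neq y)\in\mathcal G$ and $E(\mathcal G)\vdash x=y$. $EM$: $\mathcal G;x=y;\Gamma\vdash\Delta$ and $\mathcal G;x\neq y;\Gamma\vdash\Delta$ / $\mathcal G;\Gamma\vdash\Delta$. - For each frame axiom in $\mathcal{F}r$, the synthesised structural rule: for every substitution $\theta$ of labels for the $x_i$ and $\sigma$ of pairwise distinct label variables for the $y_j$, occurring neither in the conclusion nor among the labels $x_i\theta$, if $S_i\theta\in\mathcal G$ for all $i\le k$ and $E(\mathcal G)\vdash s_i\theta=t_i\theta$ for all $i\le p$: $\mathcal G;T_1\theta\sigma;\dots;T_l\theta\sigma;\Gamma\vdash\Delta$ / $\mathcal G;\Gamma\vdash\Delta$. *Theorem.* For every set $\mathcal{F}r$ of frame axioms, the cut rule $$\frac{\mathcal G;\Gamma\vdash w:A;\Delta\qquad \mathcal G';\Gamma';w:A\vdash\Delta'}{\mathcal G;\mathcal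 G';\Gamma;\Gamma'\vdash\Delta;\Delta'}$$ is admissible in the corresponding instance of $LS_G$: for all finite $\mathcal G,\mathcal G',\Gamma,\Gamma',\Delta,\Delta'$, every label $w$ and every formula $A$, if both premises are derivable without cut, then so is the conclusion. Consequently, every sequent derivable in that instance extended by the cut rule is derivable in it without cut. -/

import Mathlib

namespace LSG

/-- Formulae of propositional abstract separation logic over the propositional
variables `P`. -/
inductive Formula (P : Type*) : Type _
  | var (p : P)
  | top
  | bot
  /-- the multiplicative unit `⊤*` -/
  | emp
  | and (A B : Formula P)
  | imp (A B : Formula P)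
  /-- separating conjunction `A * B` -/
  | star (A B : Formula P)
  /-- separating implication `A -* B` -/
  | wand (A B : Formula P)

/-- Labels over a set `V` of label variables: a label variable, or the label constant `ε`. -/
inductive Label (V : Type*) : Type _
  | eps
  | var (v : V)

/-- Relational atoms over labels (or schematic labels) from `L`:
`a = b`, `a ≠ b` and `(a, b ▷ c)`. -/
inductive RelAtom (L : Type*) : Type _
  | eq (a b : L)
  | neq (a b : L)
  | rel (a b c : L)

/-- A labelled formula `w : A`. -/
structure LFormula (V P : Type*) where
  label : Label V
  formula : Formula P

noncomputable instance {L : Type*} : DecidableEq (RelAtom L) := Classical.decEq _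

noncomputable instance {V P : Type*} : DecidableEq (LFormula V P) := Classical.decEq _

/-- The label variables of a label, as a list. -/
def Label.vars {V : Type*} : Label V → List V
  | .eps => []
  | .var v => [v]

/-- The image of a label under a substitution of labels for its variables; `ε` is fixed. -/
def Label.subst {X V : Type*} (θ : X → Label V) : Label X → Label V
  | .eps => .eps
  | .var x => θ x

/-- The label variables of a relational atom, listed with repetition. -/
def RelAtom.vars {V : Type*} : RelAtom (Label V) → List V
  | .eq a b => a.vars ++ b.vars
  | .neq a b => a.vars ++ b.vars
  | .rel a b c => a.vars ++ b.vars ++ c.vars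

/-- The instance of a relational atom under a substitution of labels for its variables. -/
def RelAtom.subst {X V : Type*} (θ : X → Label V) : RelAtom (Label X) → RelAtom (Label V)
  | .eq a b => .eq (a.subst θ) (b.subst θ)
  | .neq a b => .neq (a.subst θ) (b.subst θ)
  | .rel a b c => .rel (a.subst θ) (b.subst θ) (c.subst θ)

/-- A frame axiom
`∀ x₁ … x_m, (s₁ = t₁ & … & s_p = t_p & S₁ & … & S_k ⇒ ∃ y₁ … y_n, (T₁ & … & T_l))`.
The list `eqs` holds the pairs `(sᵢ, tᵢ)`, `hyps` holds the `Sᵢ` and `concls` the `Tᵢ`.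
The schematic variables `x₁ … x_m` are `Fin m`, the variables `y₁ … y_n` are `Fin n`.
Every `Sᵢ` is an inequality or a ternary atom, `ε` does not occur in a ternary `Sᵢ`, and
every variable occurs at most once in `S₁, …, S_k`. -/
structure FrameAxiom where
  m : ℕ
  n : ℕ
  eqs : List (Label (Fin m) × Label (Fin m))
  hyps : List (RelAtom (Label (Fin m)))
  concls : List (RelAtom (Label (Fin m ⊕ Fin n)))
  hyps_not_eq : ∀ s t, RelAtom.eq s t ∉ hyps
  hyps_rel_ne_eps : ∀ a b c, RelAtom.rel a b c ∈ hyps →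
    a ≠ Label.eps ∧ b ≠ Label.eps ∧ c ≠ Label.eps
  hyps_linear : (hyps.flatMap RelAtom.vars).Nodup

/-- The judgment `E(G) ⊢ a = b`: the equation `a = b` follows from the equality atoms in `G` by
reflexivity, symmetry and transitivity. -/
def EqJudg {V : Type*} (G : Finset (RelAtom (Label V))) (a b : Label V) : Prop :=
  Relation.EqvGen (fun c d => RelAtom.eq c d ∈ G) a b

/-- The label variable `v` does not occur in the sequent `G ; Γ ⊢ Δ`. -/
def Fresh {V P : Type*} (v : V) (G : Finset (RelAtom (Label V)))
    (Γ Δ : Finset (LFormula V P)) : Prop :=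
  (∀ r ∈ G, v ∉ r.vars) ∧ (∀ F ∈ Γ, v ∉ F.label.vars) ∧ (∀ F ∈ Δ, v ∉ F.label.vars)

/-- `Derivable Ax c G Γ Δ`: the labelled sequent `G ; Γ ⊢ Δ` has a derivation in the instance of
the labelled calculus `LS_G` whose structural rules are `NEq`, `EM` and the rules synthesised from
the frame axioms in `Ax`. The cut rule may be used if `c = true`; if `c = false`, the calculus
has no cut rule. The components of a sequent are finite sets. -/
inductive Derivable {V P : Type*} (Ax : Set FrameAxiom) (c : Bool) :
    Finset (RelAtom (Label V)) → Finset (LFormula V P) → Finset (LFormula V P) → Prop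
  | id {G Γ Δ} (w w' : Label V) (p : P) (h : EqJudg G w w') :
      Derivable Ax c G (insert ⟨w, .var p⟩ Γ) (insert ⟨w', .var p⟩ Δ)
  | botL {G Γ Δ} (w : Label V) :
      Derivable Ax c G (insert ⟨w, .bot⟩ Γ) Δ
  | topR {G Γ Δ} (w : Label V) :
      Derivable Ax c G Γ (insert ⟨w, .top⟩ Δ)
  | empL {G Γ Δ} (w : Label V)
      (d : Derivable Ax c (insert (.eq w .eps) G) Γ Δ) :
      Derivable Ax c G (insert ⟨w, .emp⟩ Γ) Δ
  | empR {G Γ Δ} (w : Label V) (h : EqJudg G w .eps) :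
      Derivable Ax c G Γ (insert ⟨w, .emp⟩ Δ)
  | andL {G Γ Δ} (w : Label V) (A B : Formula P)
      (d : Derivable Ax c G (insert ⟨w, A⟩ (insert ⟨w, B⟩ Γ)) Δ) :
      Derivable Ax c G (insert ⟨w, .and A B⟩ Γ) Δ
  | andR {G Γ Δ} (w : Label V) (A B : Formula P)
      (d₁ : Derivable Ax c G Γ (insert ⟨w, A⟩ Δ))
      (d₂ : Derivable Ax c G Γ (insert ⟨w, B⟩ Δ)) :
      Derivable Ax c G Γ (insert ⟨w, .and A B⟩ Δ)
  | impL {G Γ Δ} (w : Label V) (A B : Formula P)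
      (d₁ : Derivable Ax c G Γ (insert ⟨w, A⟩ Δ))
      (d₂ : Derivable Ax c G (insert ⟨w, B⟩ Γ) Δ) :
      Derivable Ax c G (insert ⟨w, .imp A B⟩ Γ) Δ
  | impR {G Γ Δ} (w : Label V) (A B : Formula P)
      (d : Derivable Ax c G (insert ⟨w, A⟩ Γ) (insert ⟨w, B⟩ Δ)) :
      Derivable Ax c G Γ (insert ⟨w, .imp A B⟩ Δ)
  | starL {G Γ Δ} (z : Label V) (A B : Formula P) (x y : V) (hxy : x ≠ y)
      (hx : Fresh x G (insert ⟨z, .star A B⟩ Γ) Δ)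
      (hy : Fresh y G (insert ⟨z, .star A B⟩ Γ) Δ)
      (d : Derivable Ax c (insert (.rel (.var x) (.var y) z) G)
        (insert ⟨.var x, A⟩ (insert ⟨.var y, B⟩ Γ)) Δ) :
      Derivable Ax c G (insert ⟨z, .star A B⟩ Γ) Δ
  | starR {G Γ Δ} (x y z z' : Label V) (A B : Formula P)
      (hr : RelAtom.rel x y z ∈ G) (h : EqJudg G z z')
      (d₁ : Derivable Ax c G Γ (insert ⟨x, A⟩ (insert ⟨z', .star A B⟩ Δ)))
      (d₂ : Derivable Ax c G Γ (insert ⟨y, B⟩ (insert ⟨z', .star A B⟩ Δ))) :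
      Derivable Ax c G Γ (insert ⟨z', .star A B⟩ Δ)
  | wandL {G Γ Δ} (x y y' z : Label V) (A B : Formula P)
      (hr : RelAtom.rel x y z ∈ G) (h : EqJudg G y y')
      (d₁ : Derivable Ax c G (insert ⟨y', .wand A B⟩ Γ) (insert ⟨x, A⟩ Δ))
      (d₂ : Derivable Ax c G (insert ⟨z, B⟩ (insert ⟨y', .wand A B⟩ Γ)) Δ) :
      Derivable Ax c G (insert ⟨y', .wand A B⟩ Γ) Δ
  | wandR {G Γ Δ} (z : Label V) (A B : Formula P) (x y : V) (hxy : x ≠ y)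
      (hx : Fresh x G Γ (insert ⟨z, .wand A B⟩ Δ))
      (hy : Fresh y G Γ (insert ⟨z, .wand A B⟩ Δ))
      (d : Derivable Ax c (insert (.rel (.var x) z (.var y)) G)
        (insert ⟨.var x, A⟩ Γ) (insert ⟨.var y, B⟩ Δ)) :
      Derivable Ax c G Γ (insert ⟨z, .wand A B⟩ Δ)
  | nEq {G Γ Δ} (x y : Label V) (hr : RelAtom.neq x y ∈ G) (h : EqJudg G x y) :
      Derivable Ax c G Γ Δ
  | em {G Γ Δ} (x y : Label V)
      (d₁ : Derivable Ax c (insert (.eq x y) G) Γ Δ)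
      (d₂ : Derivable Ax c (insert (.neq x y) G) Γ Δ) :
      Derivable Ax c G Γ Δ
  /-- The structural rule synthesised from the frame axiom `F`. The substitution `θ` instantiates
  the variables `xᵢ` by labels; `σ` instantiates the variables `yⱼ` by pairwise distinct label
  variables that occur neither in the conclusion nor in the labels `θ xᵢ`. -/
  | frame {G Γ Δ} (F : FrameAxiom) (hF : F ∈ Ax) (θ : Fin F.m → Label V) (σ : Fin F.n → V)
      (hσ : Function.Injective σ)
      (hσ_fresh : ∀ j, Fresh (σ j) G Γ Δ)
      (hσ_ne : ∀ j i, θ i ≠ Label.var (σ j))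
      (heqs : ∀ e ∈ F.eqs, EqJudg G (e.1.subst θ) (e.2.subst θ))
      (hhyps : ∀ S ∈ F.hyps, S.subst θ ∈ G)
      (d : Derivable Ax c
        (G ∪ (F.concls.map (RelAtom.subst (Sum.elim θ (fun j => Label.var (σ j))))).toFinset)
        Γ Δ) :
      Derivable Ax c G Γ Δ
  | cut {G G' Γ Γ' Δ Δ'} (hc : c = true) (w : Label V) (A : Formula P)
      (d₁ : Derivable Ax c G Γ (insert ⟨w, A⟩ Δ))
      (d₂ : Derivable Ax c G' (insert ⟨w, A⟩ Γ') Δ') :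
      Derivable Ax c (G ∪ G') (Γ ∪ Γ') (Δ ∪ Δ')

end LSG

namespace LSG

variable {V P : Type*}

/-! ### Equality and satisfaction of relational atoms -/

/-! The argument is semantic, in the style of Okada's phase-semantic cut elimination. Worlds are
sequents ordered by inclusion, and cut-free provability plays the role of absurdity. `Forces`
interprets a labelled formula as a set of worlds stable under the resulting double negation
(`Closure`), and `Refutes` is the corresponding negation. Two labels are identified at a world when
its equality atoms force it.

Three facts carry the proof. By `forces_and_refutes`, formulae on the left of a world are forced and
those on the right refuted; this uses only cut-free rules. By `Derivable.valid`, every rule, cut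
included, is sound; cut is harmless because a formula forced and refuted at one world makes that
world provable. By `Valid.derivable`, a sequent is a model of itself under the identity valuation,
so validity returns a cut-free derivation. No weakening, invertibility or substitution lemma for
derivations is needed, and contraction is built into finite sets.

The delicate case is a frame rule (`Valid.frame`): its hypotheses hold in a model only up to
equality, whereas the rule demands literal membership. Linearity of the hypotheses and the absence
of `ε` in the ternary ones allow ternary atoms to be matched by changing the instantiation, and `EM`
with `NEq` supplies the inequalities literally. -/

theorem EqJudg.refl {G : Finset (RelAtom (Label V))} (a : Label V) : EqJudg G a a :=
  Relation.EqvGen.refl a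

theorem EqJudg.symm {G : Finset (RelAtom (Label V))} {a b : Label V} (h : EqJudg G a b) :
    EqJudg G b a :=
  Relation.EqvGen.symm _ _ h

theorem EqJudg.trans {G : Finset (RelAtom (Label V))} {a b c : Label V} (h : EqJudg G a b)
    (h' : EqJudg G b c) : EqJudg G a c :=
  Relation.EqvGen.trans _ _ _ h h'

theorem EqJudg.of_mem {G : Finset (RelAtom (Label V))} {a b : Label V}
    (h : RelAtom.eq a b ∈ G) : EqJudg G a b :=
  Relation.EqvGen.rel _ _ h

theorem EqJudg.mono {G G' : Finset (RelAtom (Label V))} (hG : G ⊆ G') {a b : Label V}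
    (h : EqJudg G a b) : EqJudg G' a b :=
  Relation.EqvGen.mono (fun _ _ hab => hG hab) _ _ h

/-- The relational atom belongs to `G` up to the equality generated by `G`. -/
def Holds (G : Finset (RelAtom (Label V))) : RelAtom (Label V) → Prop
  | .eq a b => EqJudg G a b
  | .neq a b => ∃ a' b', RelAtom.neq a' b' ∈ G ∧ EqJudg G a a' ∧ EqJudg G b b'
  | .rel a b c => ∃ a' b' c', RelAtom.rel a' b' c' ∈ G ∧
      EqJudg G a a' ∧ EqJudg G b b' ∧ EqJudg G c c'

theorem Holds.of_mem {G : Finset (RelAtom (Label V))} {r : RelAtom (Label V)} (h : r ∈ G) :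
    Holds G r := by
  cases r with
  | eq a b => exact EqJudg.of_mem h
  | neq a b => exact ⟨a, b, h, .refl _, .refl _⟩
  | rel a b c => exact ⟨a, b, c, h, .refl _, .refl _, .refl _⟩

theorem Holds.mono {G G' : Finset (RelAtom (Label V))} (hG : G ⊆ G') {r : RelAtom (Label V)}
    (h : Holds G r) : Holds G' r := by
  cases r with
  | eq a b => exact EqJudg.mono hG h
  | neq a b =>
    obtain ⟨a', b', hr, ha, hb⟩ := h
    exact ⟨a', b', hG hr, ha.mono hG, hb.mono hG⟩
  | rel a b c =>
    obtain ⟨a', b', c', hr, ha, hb, hc⟩ := h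
    exact ⟨a', b', c', hG hr, ha.mono hG, hb.mono hG, hc.mono hG⟩

theorem Holds.rel_congr {G : Finset (RelAtom (Label V))} {a b c a' b' c' : Label V}
    (h : Holds G (.rel a b c)) (ha : EqJudg G a' a) (hb : EqJudg G b' b) (hc : EqJudg G c' c) :
    Holds G (.rel a' b' c') := by
  obtain ⟨u, v, w, hr, hu, hv, hw⟩ := h
  exact ⟨u, v, w, hr, ha.trans hu, hb.trans hv, hc.trans hw⟩

theorem Label.subst_eqJudg {X : Type*} {G : Finset (RelAtom (Label V))} {θ θ' : X → Label V}
    (h : ∀ i, EqJudg G (θ i) (θ' i)) (l : Label X) : EqJudg G (l.subst θ) (l.subst θ') := by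
  cases l with
  | eps => exact .refl _
  | var i => exact h i

theorem Holds.subst_congr {X : Type*} {G : Finset (RelAtom (Label V))} {θ θ' : X → Label V}
    (h : ∀ i, EqJudg G (θ i) (θ' i)) {r : RelAtom (Label X)} (hr : Holds G (r.subst θ')) :
    Holds G (r.subst θ) := by
  cases r with
  | eq a b =>
    exact (Label.subst_eqJudg h a).trans (EqJudg.trans hr (Label.subst_eqJudg h b).symm)
  | neq a b =>
    obtain ⟨a', b', hr, ha, hb⟩ := hr
    exact ⟨a', b', hr, (Label.subst_eqJudg h a).trans ha, (Label.subst_eqJudg h b).trans hb⟩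
  | rel a b c =>
    exact Holds.rel_congr hr (Label.subst_eqJudg h a) (Label.subst_eqJudg h b)
      (Label.subst_eqJudg h c)

/-! ### Substitution -/

theorem Label.subst_subst {X Y : Type*} (θ : X → Label Y) (ρ : Y → Label V) (l : Label X) :
    (l.subst θ).subst ρ = l.subst (fun i => (θ i).subst ρ) := by
  cases l <;> rfl

theorem RelAtom.subst_subst {X Y : Type*} (θ : X → Label Y) (ρ : Y → Label V)
    (r : RelAtom (Label X)) :
    (r.subst θ).subst ρ = r.subst (fun i => (θ i).subst ρ) := by
  cases r <;> simp [RelAtom.subst, Label.subst_subst]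

theorem Label.subst_congr {X : Type*} {θ θ' : X → Label V} {l : Label X}
    (h : ∀ i ∈ l.vars, θ i = θ' i) : l.subst θ = l.subst θ' := by
  cases l with
  | eps => rfl
  | var i => exact h i (by simp [Label.vars])

theorem RelAtom.subst_congr {X : Type*} {θ θ' : X → Label V} {r : RelAtom (Label X)}
    (h : ∀ i ∈ r.vars, θ i = θ' i) : r.subst θ = r.subst θ' := by
  cases r with
  | eq a b | neq a b =>
    simp only [RelAtom.subst]
    rw [Label.subst_congr (l := a) fun i hi => h i (by simp [RelAtom.vars, hi]),
      Label.subst_congr (l := b) fun i hi => h i (by simp [RelAtom.vars, hi])]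
  | rel a b c =>
    simp only [RelAtom.subst]
    rw [Label.subst_congr (l := a) fun i hi => h i (by simp [RelAtom.vars, hi]),
      Label.subst_congr (l := b) fun i hi => h i (by simp [RelAtom.vars, hi]),
      Label.subst_congr (l := c) fun i hi => h i (by simp [RelAtom.vars, hi])]

theorem Label.subst_var (l : Label V) : l.subst Label.var = l := by
  cases l <;> rfl

theorem RelAtom.subst_var (r : RelAtom (Label V)) : r.subst Label.var = r := by
  cases r <;> simp [RelAtom.subst, Label.subst_var]

/-- Soundness of the side conditions `E(G) ⊢ a = b`: only the equality atoms of `G` matter, and a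
valuation turns these into equalities of the world. -/
theorem EqJudg.subst {G G' : Finset (RelAtom (Label V))} {ρ : V → Label V}
    (hG : ∀ r ∈ G, Holds G' (r.subst ρ)) {a b : Label V} (h : EqJudg G a b) :
    EqJudg G' (a.subst ρ) (b.subst ρ) := by
  induction h with
  | rel a b h => exact hG _ h
  | refl a => exact .refl _
  | symm a b _ ih => exact ih.symm
  | trans a b c _ _ ih ih' => exact ih.trans ih'

/-- By linearity, the hypotheses of a frame axiom that hold up to equality can be matched
literally after replacing the instantiating labels by equal ones. -/
theorem exists_subst_mem {X : Type*} {G : Finset (RelAtom (Label V))} {θ : X → Label V}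
    (hs : List (RelAtom (Label X))) (hlin : (hs.flatMap RelAtom.vars).Nodup)
    (heps : ∀ a b c, RelAtom.rel a b c ∈ hs → a ≠ .eps ∧ b ≠ .eps ∧ c ≠ .eps)
    (hmem : ∀ r ∈ hs, r.subst θ ∈ G ∨
      ∃ a b c, r = RelAtom.rel a b c ∧ Holds G (r.subst θ)) :
    ∃ θ' : X → Label V, (∀ i, EqJudg G (θ i) (θ' i)) ∧ ∀ r ∈ hs, r.subst θ' ∈ G := by
  classical
  induction hs with
  | nil => exact ⟨θ, fun _ => .refl _, by simp⟩
  | cons r hs ih =>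
    rw [List.flatMap_cons, List.nodup_append'] at hlin
    obtain ⟨hr, hhs, hdisj⟩ := hlin
    obtain ⟨θ₁, hθ₁, hmem₁⟩ := ih hhs (fun a b c h => heps a b c (List.mem_cons_of_mem _ h))
      (fun r h => hmem r (List.mem_cons_of_mem _ h))
    obtain ⟨θ₂, hθ₂, hmem₂⟩ : ∃ θ₂ : X → Label V,
        (∀ i, EqJudg G (θ i) (θ₂ i)) ∧ r.subst θ₂ ∈ G := by
      rcases hmem r List.mem_cons_self with h | ⟨a, b, c, rfl, h⟩
      · exact ⟨θ, fun _ => .refl _, h⟩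
      · obtain ⟨ha, hb, hc⟩ := heps a b c List.mem_cons_self
        cases a with | eps => exact absurd rfl ha | var a =>
        cases b with | eps => exact absurd rfl hb | var b =>
        cases c with | eps => exact absurd rfl hc | var c =>
        obtain ⟨a', b', c', hG, hea, heb, hec⟩ := h
        simp only [RelAtom.vars, Label.vars, List.cons_append, List.nil_append,
          List.nodup_cons, List.mem_cons, List.not_mem_nil, or_false, not_or] at hr
        obtain ⟨⟨hab, hac⟩, hbc, -⟩ := hr
        -- The three variables are distinct by linearity, so each can be sent independently to the
        -- label that occurs literally in `G`.
        refine ⟨fun i => if i = a then a' else if i = b then b' else if i = c then c' else θ i,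
          fun i => ?_, ?_⟩
        · dsimp only
          split_ifs with h₁ h₂ h₃
          · exact h₁ ▸ hea
          · exact h₂ ▸ heb
          · exact h₃ ▸ hec
          · exact .refl _
        · simpa [RelAtom.subst, Label.subst, Ne.symm hab, Ne.symm hac, Ne.symm hbc] using hG
    -- Linearity also makes the variables of `r` disjoint from those of the other atoms, so the two
    -- instantiations can be glued.
    refine ⟨fun i => if i ∈ r.vars then θ₂ i else θ₁ i, fun i => ?_, ?_⟩
    · dsimp only
      split_ifs
      · exact hθ₂ i
      · exact hθ₁ i
    · intro s hs'
      rcases List.mem_cons.1 hs' with rfl | hs'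
      · rw [RelAtom.subst_congr (θ' := θ₂) fun i hi => if_pos hi]
        exact hmem₂
      · rw [RelAtom.subst_congr (θ' := θ₁) fun i hi => if_neg fun hir =>
          hdisj hir (List.mem_flatMap.2 ⟨s, hs', hi⟩)]
        exact hmem₁ s hs'

/-! ### Sequents -/

/-- A sequent `rels ; left ⊢ right`. -/
structure Sequent (V P : Type*) where
  rels : Finset (RelAtom (Label V))
  left : Finset (LFormula V P)
  right : Finset (LFormula V P)

/-- Sequents are ordered by componentwise inclusion. -/
instance : Preorder (Sequent V P) where
  le S T := S.rels ⊆ T.rels ∧ S.left ⊆ T.left ∧ S.right ⊆ T.right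
  le_refl _ := ⟨subset_rfl, subset_rfl, subset_rfl⟩
  le_trans _ _ _ h h' := ⟨h.1.trans h'.1, h.2.1.trans h'.2.1, h.2.2.trans h'.2.2⟩

/-- Cut-free derivability. -/
def Sequent.Provable (Ax : Set FrameAxiom) (S : Sequent V P) : Prop :=
  Derivable Ax false S.rels S.left S.right

/-- The labelled formula occurs on the left, up to equality of labels. -/
def Sequent.InLeft (S : Sequent V P) (w : Label V) (A : Formula P) : Prop :=
  ∃ w', ⟨w', A⟩ ∈ S.left ∧ EqJudg S.rels w w'

/-- The labelled formula occurs on the right, up to equality of labels. -/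
def Sequent.InRight (S : Sequent V P) (w : Label V) (A : Formula P) : Prop :=
  ∃ w', ⟨w', A⟩ ∈ S.right ∧ EqJudg S.rels w w'

theorem Sequent.InLeft.mono {S T : Sequent V P} (h : S ≤ T) {w : Label V} {A : Formula P}
    (hS : S.InLeft w A) : T.InLeft w A :=
  let ⟨w', hw, he⟩ := hS
  ⟨w', h.2.1 hw, he.mono h.1⟩

theorem Sequent.InRight.mono {S T : Sequent V P} (h : S ≤ T) {w : Label V} {A : Formula P}
    (hS : S.InRight w A) : T.InRight w A :=
  let ⟨w', hw, he⟩ := hS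
  ⟨w', h.2.2 hw, he.mono h.1⟩

/-- The extra set `L` is for the frame rules, whose eigenvariables must also avoid instantiating
labels that need not occur in the sequent. -/
theorem Sequent.exists_fresh [Infinite V] (S : Sequent V P) (L : Finset (Label V)) :
    ∃ σ : ℕ → V, Function.Injective σ ∧ (∀ j, Fresh (σ j) S.rels S.left S.right) ∧
      ∀ j, ∀ l ∈ L, l ≠ Label.var (σ j) := by
  classical
  let N : Finset V := S.rels.biUnion (fun r => r.vars.toFinset) ∪
    S.left.biUnion (fun F => F.label.vars.toFinset) ∪
    S.right.biUnion (fun F => F.label.vars.toFinset) ∪ L.biUnion (fun l => l.vars.toFinset)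
  have hinf : Infinite ↥((N : Set V)ᶜ) := N.finite_toSet.infinite_compl.to_subtype
  let e := Infinite.natEmbedding ↥((N : Set V)ᶜ)
  have hN : ∀ j, (e j : V) ∉ N := fun j => (e j).2
  refine ⟨fun j => e j, Subtype.val_injective.comp e.injective,
    fun j => ⟨fun r hr hv => hN j ?_, fun F hF hv => hN j ?_, fun F hF hv => hN j ?_⟩,
    fun j l hl hlv => hN j ?_⟩
  · simp only [N, Finset.mem_union, Finset.mem_biUnion, List.mem_toFinset]
    exact .inl (.inl (.inl ⟨r, hr, hv⟩))
  · simp only [N, Finset.mem_union, Finset.mem_biUnion, List.mem_toFinset]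
    exact .inl (.inl (.inr ⟨F, hF, hv⟩))
  · simp only [N, Finset.mem_union, Finset.mem_biUnion, List.mem_toFinset]
    exact .inl (.inr ⟨F, hF, hv⟩)
  · simp only [N, Finset.mem_union, Finset.mem_biUnion, List.mem_toFinset]
    exact .inr ⟨l, hl, by rw [hlv]; exact List.mem_singleton.2 rfl⟩

/-- By `EM` and `NEq`, the inequalities that hold up to equality may be added to a sequent. -/
theorem Sequent.provable_of_neq {Ax : Set FrameAxiom} (hs : List (RelAtom (Label V))) :
    ∀ S : Sequent V P, (∀ r ∈ hs, Holds S.rels r) →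
      (∀ T : Sequent V P, S ≤ T → (∀ a b, RelAtom.neq a b ∈ hs → RelAtom.neq a b ∈ T.rels) →
        T.Provable Ax) → S.Provable Ax := by
  induction hs with
  | nil => exact fun S _ hT => hT S le_rfl (by simp)
  | cons r hs ih =>
    intro S hr hT
    by_cases hneq : ∃ a b, r = .neq a b
    · obtain ⟨a, b, rfl⟩ := hneq
      -- In the branch with `a = b`, the atom `a' ≠ b'` present up to equality becomes contradictory
      -- and `NEq` closes it. The other branch contains the required literal inequality.
      refine Derivable.em a b ?_ ?_
      · obtain ⟨a', b', hm, ha, hb⟩ := hr _ List.mem_cons_self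
        have hsub : S.rels ⊆ insert (.eq a b) S.rels := Finset.subset_insert _ _
        exact .nEq a' b' (hsub hm) ((ha.mono hsub).symm.trans
          ((EqJudg.of_mem (Finset.mem_insert_self _ _)).trans (hb.mono hsub)))
      · have hle : S ≤ ⟨insert (.neq a b) S.rels, S.left, S.right⟩ :=
          ⟨Finset.subset_insert _ _, subset_rfl, subset_rfl⟩
        refine ih ⟨insert (.neq a b) S.rels, S.left, S.right⟩
          (fun r h => (hr r (List.mem_cons_of_mem _ h)).mono hle.1) fun T hST hTn =>
            hT T (hle.trans hST) fun a' b' h => ?_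
        rcases List.mem_cons.1 h with h | h
        · rw [h]
          exact hST.1 (Finset.mem_insert_self _ _)
        · exact hTn _ _ h
    · refine ih S (fun r h => hr r (List.mem_cons_of_mem _ h)) fun T hST hTn =>
        hT T hST fun a b h => ?_
      rcases List.mem_cons.1 h with h | h
      · exact absurd ⟨a, b, h.symm⟩ hneq
      · exact hTn _ _ h

/-! ### Forcing -/

/-- The closure of a property of sequents with respect to cut-free derivability. -/
def Closure (Ax : Set FrameAxiom) (X : Sequent V P → Prop) (S : Sequent V P) : Prop :=
  ∀ T, S ≤ T → (∀ U, T ≤ U → X U → U.Provable Ax) → T.Provable Ax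

/-- The interpretation of labelled formulae as properties of sequents. -/
def Forces (Ax : Set FrameAxiom) : Formula P → Label V → Sequent V P → Prop
  | .var p, w => fun S => ∀ T, S ≤ T → T.InRight w (.var p) → T.Provable Ax
  | .top, _ => fun _ => True
  | .bot, _ => fun S => ∀ T, S ≤ T → T.Provable Ax
  | .emp, w => Closure Ax fun S => EqJudg S.rels w .eps
  | .and A B, w => fun S => Forces Ax A w S ∧ Forces Ax B w S
  | .imp A B, w => fun S => ∀ T, S ≤ T → Forces Ax A w T → Forces Ax B w T
  | .star A B, z => Closure Ax fun S =>
      ∃ x y, Holds S.rels (.rel x y z) ∧ Forces Ax A x S ∧ Forces Ax B y S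
  | .wand A B, z => fun S => ∀ T, S ≤ T → ∀ x y, Holds T.rels (.rel x z y) →
      Forces Ax A x T → Forces Ax B y T

/-- Every sequent extending the given one and forcing the labelled formula is provable. -/
def Refutes (Ax : Set FrameAxiom) (A : Formula P) (w : Label V) (S : Sequent V P) : Prop :=
  ∀ T, S ≤ T → Forces Ax A w T → T.Provable Ax

theorem Closure.mono {Ax : Set FrameAxiom} {X : Sequent V P → Prop} {S T : Sequent V P}
    (h : S ≤ T) (hS : Closure Ax X S) : Closure Ax X T :=
  fun U hU => hS U (h.trans hU)

theorem Closure.of {Ax : Set FrameAxiom} {X : Sequent V P → Prop} {S : Sequent V P}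
    (h : ∀ T, S ≤ T → X T) : Closure Ax X S :=
  fun T hT hX => hX T le_rfl (h T hT)

theorem Forces.mono {Ax : Set FrameAxiom} {A : Formula P} {w : Label V} {S T : Sequent V P}
    (h : S ≤ T) (hS : Forces Ax A w S) : Forces Ax A w T := by
  induction A generalizing w with
  | var p => exact fun U hU => hS U (h.trans hU)
  | top => trivial
  | bot => exact fun U hU => hS U (h.trans hU)
  | emp => exact Closure.mono h hS
  | and A B ihA ihB => exact ⟨ihA hS.1, ihB hS.2⟩
  | imp A B => exact fun U hU => hS U (h.trans hU)
  | star A B => exact Closure.mono h hS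
  | wand A B => exact fun U hU => hS U (h.trans hU)

theorem Refutes.mono {Ax : Set FrameAxiom} {A : Formula P} {w : Label V} {S T : Sequent V P}
    (h : S ≤ T) (hS : Refutes Ax A w S) : Refutes Ax A w T :=
  fun U hU => hS U (h.trans hU)

theorem Closure.idem {Ax : Set FrameAxiom} {X : Sequent V P → Prop} {S : Sequent V P}
    (hS : Closure Ax (Closure Ax X) S) : Closure Ax X S :=
  fun T hT hX => hS T hT fun U hU hXU => hXU U le_rfl fun W hW => hX W (hU.trans hW)

theorem Closure.map {Ax : Set FrameAxiom} {X Y : Sequent V P → Prop} {S : Sequent V P}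
    (h : ∀ T, S ≤ T → X T → Y T) (hS : Closure Ax X S) : Closure Ax Y S :=
  fun T hT hY => hS T hT fun U hU hX => hY U hU (h U (hT.trans hU) hX)

/-- The clauses for `emp` and `star` are closures by definition, those for variables and `bot` are
negations, and implications inherit stability from their consequent. -/
theorem Forces.of_closure {Ax : Set FrameAxiom} {A : Formula P} {w : Label V}
    {S : Sequent V P} (hS : Closure Ax (Forces Ax A w) S) : Forces Ax A w S := by
  induction A generalizing w S with
  | var p => exact fun T hT hR => hS T hT fun U hU hF => hF U le_rfl (hR.mono hU)
  | top => trivial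
  | bot => exact fun T hT => hS T hT fun U _ hF => hF U le_rfl
  | emp => exact hS.idem
  | and A B ihA ihB =>
    exact ⟨ihA (hS.map fun _ _ h => h.1), ihB (hS.map fun _ _ h => h.2)⟩
  | imp A B ihA ihB =>
    exact fun T hT hA => ihB <| (hS.mono hT).map fun U hU h => h U le_rfl (hA.mono hU)
  | star A B => exact hS.idem
  | wand A B ihA ihB =>
    exact fun T hT x y hr hA => ihB <|
      (hS.mono hT).map fun U hU h => h U le_rfl x y (hr.mono hU.1) (hA.mono hU)

/-- Double negation elimination for forcing; this makes classical sequents with several formulae on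
the right sound. -/
theorem Forces.of_refutes {Ax : Set FrameAxiom} {A : Formula P} {w : Label V}
    {S : Sequent V P} (h : ∀ T, S ≤ T → Refutes Ax A w T → T.Provable Ax) : Forces Ax A w S :=
  .of_closure fun T hT hR => h T hT hR

/-- A formula occurring on the left is forced and a formula occurring on the right is refuted. -/
theorem forces_and_refutes [Infinite V] {Ax : Set FrameAxiom} (A : Formula P) :
    ∀ (w : Label V) (S : Sequent V P),
      (S.InLeft w A → Forces Ax A w S) ∧ (S.InRight w A → Refutes Ax A w S) := by
  induction A with
  | var p =>
    refine fun w S => ⟨fun hL T hT hR => ?_, fun hR T hT hF => hF T le_rfl (hR.mono hT)⟩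
    obtain ⟨w₁, hm₁, h₁⟩ := hL.mono hT
    obtain ⟨w₂, hm₂, h₂⟩ := hR
    have d := Derivable.id (Ax := Ax) (c := false) (Γ := T.left) (Δ := T.right) w₁ w₂ p
      (h₁.symm.trans h₂)
    -- The principal formulae already belong to `T`, so as sets the conclusion is `T` itself. The
    -- same absorption recurs in all cases below.
    rwa [Finset.insert_eq_of_mem hm₁, Finset.insert_eq_of_mem hm₂] at d
  | top =>
    refine fun w S => ⟨fun _ => trivial, fun hR T hT _ => ?_⟩
    obtain ⟨w₁, hm₁, h₁⟩ := hR.mono hT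
    have d := Derivable.topR (Ax := Ax) (c := false) (G := T.rels) (Γ := T.left)
      (Δ := T.right) w₁
    rwa [Finset.insert_eq_of_mem hm₁] at d
  | bot =>
    refine fun w S => ⟨fun hL T hT => ?_, fun _ T _ hF => hF T le_rfl⟩
    obtain ⟨w₁, hm₁, h₁⟩ := hL.mono hT
    have d := Derivable.botL (Ax := Ax) (c := false) (G := T.rels) (Γ := T.left)
      (Δ := T.right) w₁
    rwa [Finset.insert_eq_of_mem hm₁] at d
  | emp =>
    refine fun w S => ⟨fun hL T hT hX => ?_, fun hR T hT hF => hF T le_rfl fun U hU hX => ?_⟩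
    · obtain ⟨w₁, hm₁, h₁⟩ := hL.mono hT
      have hsub : T.rels ⊆ insert (RelAtom.eq w₁ .eps) T.rels := Finset.subset_insert _ _
      have d := Derivable.empL w₁ <| hX ⟨insert (RelAtom.eq w₁ .eps) T.rels, T.left, T.right⟩
        ⟨hsub, subset_rfl, subset_rfl⟩
        ((h₁.mono hsub).trans (.of_mem (Finset.mem_insert_self _ _)))
      rwa [Finset.insert_eq_of_mem hm₁] at d
    · obtain ⟨w₁, hm₁, h₁⟩ := hR.mono (hT.trans hU)
      have d := Derivable.empR (Ax := Ax) (c := false) (Γ := U.left) (Δ := U.right) w₁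
        (h₁.symm.trans hX)
      rwa [Finset.insert_eq_of_mem hm₁] at d
  | and A B ihA ihB =>
    refine fun w S => ⟨fun hL => ?_, fun hR T hT hF => ?_⟩
    -- The left rule adds both conjuncts at once; stability of each conjunct then lets it be
    -- extracted separately.
    · have key : ∀ T, S ≤ T → (∀ U, T ≤ U → Forces Ax A w U → Forces Ax B w U →
          U.Provable Ax) → T.Provable Ax := by
        intro T hT hU
        obtain ⟨w₁, hm₁, h₁⟩ := hL.mono hT
        have d := Derivable.andL w₁ A B <|
          hU ⟨T.rels, insert (LFormula.mk w₁ A) (insert (LFormula.mk w₁ B) T.left), T.right⟩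
          ⟨subset_rfl, (Finset.subset_insert _ _).trans (Finset.subset_insert _ _), subset_rfl⟩
          ((ihA _ _).1 ⟨w₁, by simp, h₁⟩) ((ihB _ _).1 ⟨w₁, by simp, h₁⟩)
        rwa [Finset.insert_eq_of_mem hm₁] at d
      exact ⟨.of_closure fun T hT hX => key T hT fun U hU hA _ => hX U hU hA,
        .of_closure fun T hT hX => key T hT fun U hU _ hB => hX U hU hB⟩
    · obtain ⟨w₁, hm₁, h₁⟩ := hR.mono hT
      have hle : ∀ C : Formula P, T ≤ ⟨T.rels, T.left, insert (LFormula.mk w₁ C) T.right⟩ :=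
        fun C => ⟨subset_rfl, subset_rfl, Finset.subset_insert _ _⟩
      have d := Derivable.andR w₁ A B
        ((ihA w ⟨T.rels, T.left, insert (LFormula.mk w₁ A) T.right⟩).2 ⟨w₁, by simp, h₁⟩ _ le_rfl
          (hF.1.mono (hle A)))
        ((ihB w ⟨T.rels, T.left, insert (LFormula.mk w₁ B) T.right⟩).2 ⟨w₁, by simp, h₁⟩ _ le_rfl
          (hF.2.mono (hle B)))
      rwa [Finset.insert_eq_of_mem hm₁] at d
  | imp A B ihA ihB =>
    refine fun w S => ⟨fun hL T hT hA => .of_closure fun U hU hX => ?_, fun hR T hT hF => ?_⟩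
    · obtain ⟨w₁, hm₁, h₁⟩ := hL.mono (hT.trans hU)
      have hle : U ≤ ⟨U.rels, U.left, insert (LFormula.mk w₁ A) U.right⟩ :=
        ⟨subset_rfl, subset_rfl, Finset.subset_insert _ _⟩
      have d := Derivable.impL w₁ A B
        ((ihA w ⟨U.rels, U.left, insert (LFormula.mk w₁ A) U.right⟩).2 ⟨w₁, by simp, h₁⟩ _ le_rfl
          (hA.mono (hU.trans hle)))
        (hX ⟨U.rels, insert (LFormula.mk w₁ B) U.left, U.right⟩
          ⟨subset_rfl, Finset.subset_insert _ _, subset_rfl⟩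
          ((ihB _ _).1 ⟨w₁, by simp, h₁⟩))
      rwa [Finset.insert_eq_of_mem hm₁] at d
    · obtain ⟨w₁, hm₁, h₁⟩ := hR.mono hT
      have d := Derivable.impR w₁ A B <|
        (ihB w ⟨T.rels, insert (LFormula.mk w₁ A) T.left, insert (LFormula.mk w₁ B) T.right⟩).2
          ⟨w₁, by simp, h₁⟩ _ le_rfl <|
        hF _ ⟨subset_rfl, Finset.subset_insert _ _, Finset.subset_insert _ _⟩ <|
        (ihA _ _).1 ⟨w₁, by simp, h₁⟩
      rwa [Finset.insert_eq_of_mem hm₁] at d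
  | star A B ihA ihB =>
    refine fun z S => ⟨fun hL T hT hX => ?_, fun hR T hT hF => hF T le_rfl ?_⟩
    · obtain ⟨z₁, hm₁, h₁⟩ := hL.mono hT
      obtain ⟨σ, hσ, hfresh, -⟩ := T.exists_fresh ∅
      have hsub : T.rels ⊆ insert (RelAtom.rel (.var (σ 0)) (.var (σ 1)) z₁) T.rels :=
        Finset.subset_insert _ _
      -- The rule introduces a triple ending in the representative `z₁` found on the left; equality
      -- transports it to `z`.
      have hrel : Holds (insert (RelAtom.rel (.var (σ 0)) (.var (σ 1)) z₁) T.rels)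
          (.rel (.var (σ 0)) (.var (σ 1)) z) :=
        Holds.rel_congr (.of_mem (Finset.mem_insert_self _ _)) (.refl _) (.refl _)
          (h₁.mono hsub)
      have d := Derivable.starL (Ax := Ax) (c := false) (G := T.rels) (Γ := T.left)
        (Δ := T.right) z₁ A B (σ 0) (σ 1) (hσ.ne (by decide))
        (by rw [Finset.insert_eq_of_mem hm₁]; exact hfresh 0)
        (by rw [Finset.insert_eq_of_mem hm₁]; exact hfresh 1)
        (hX ⟨_, insert (LFormula.mk (.var (σ 0)) A) (insert (LFormula.mk (.var (σ 1)) B) T.left), T.right⟩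
          ⟨hsub, (Finset.subset_insert _ _).trans (Finset.subset_insert _ _), subset_rfl⟩
          ⟨_, _, hrel, (ihA _ _).1 ⟨_, by simp, .refl _⟩, (ihB _ _).1 ⟨_, by simp, .refl _⟩⟩)
      rwa [Finset.insert_eq_of_mem hm₁] at d
    · rintro U hU ⟨x, y, ⟨x₁, y₁, z₁, hr, hx, hy, hz⟩, hA, hB⟩
      obtain ⟨z₂, hm₂, h₂⟩ := hR.mono (hT.trans hU)
      have hle : ∀ F, U ≤ ⟨U.rels, U.left, insert F U.right⟩ :=
        fun F => ⟨subset_rfl, subset_rfl, Finset.subset_insert _ _⟩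
      have d := Derivable.starR (Δ := U.right) x₁ y₁ z₁ z₂ A B hr (hz.symm.trans h₂)
        (by
          rw [Finset.insert_eq_of_mem hm₂]
          exact (ihA x ⟨U.rels, U.left, insert (LFormula.mk x₁ A) U.right⟩).2 ⟨x₁, by simp, hx⟩ _ le_rfl
            (hA.mono (hle _)))
        (by
          rw [Finset.insert_eq_of_mem hm₂]
          exact (ihB y ⟨U.rels, U.left, insert (LFormula.mk y₁ B) U.right⟩).2 ⟨y₁, by simp, hy⟩ _ le_rfl
            (hB.mono (hle _)))
      rwa [Finset.insert_eq_of_mem hm₂] at d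
  | wand A B ihA ihB =>
    refine fun z S => ⟨fun hL T hT x y hr hA => .of_closure fun U hU hX => ?_,
      fun hR T hT hF => ?_⟩
    · obtain ⟨z₂, hm₂, h₂⟩ := hL.mono (hT.trans hU)
      obtain ⟨x₁, z₁, y₁, hr, hx, hz, hy⟩ := hr.mono hU.1
      have hle : ∀ F, U ≤ ⟨U.rels, U.left, insert F U.right⟩ :=
        fun F => ⟨subset_rfl, subset_rfl, Finset.subset_insert _ _⟩
      have d := Derivable.wandL (Γ := U.left) x₁ z₁ z₂ y₁ A B hr (hz.symm.trans h₂)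
        (by
          rw [Finset.insert_eq_of_mem hm₂]
          exact (ihA x ⟨U.rels, U.left, insert (LFormula.mk x₁ A) U.right⟩).2 ⟨x₁, by simp, hx⟩ _ le_rfl
            (hA.mono (hU.trans (hle _))))
        (by
          rw [Finset.insert_eq_of_mem hm₂]
          exact hX ⟨U.rels, insert (LFormula.mk y₁ B) U.left, U.right⟩
            ⟨subset_rfl, Finset.subset_insert _ _, subset_rfl⟩
            ((ihB _ _).1 ⟨y₁, by simp, hy⟩))
      rwa [Finset.insert_eq_of_mem hm₂] at d
    · obtain ⟨z₁, hm₁, h₁⟩ := hR.mono hT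
      obtain ⟨σ, hσ, hfresh, -⟩ := T.exists_fresh ∅
      have hsub : T.rels ⊆ insert (RelAtom.rel (.var (σ 0)) z₁ (.var (σ 1))) T.rels :=
        Finset.subset_insert _ _
      have hrel : Holds (insert (RelAtom.rel (.var (σ 0)) z₁ (.var (σ 1))) T.rels)
          (.rel (.var (σ 0)) z (.var (σ 1))) :=
        Holds.rel_congr (.of_mem (Finset.mem_insert_self _ _)) (.refl _)
          (h₁.mono hsub) (.refl _)
      have d := Derivable.wandR (Ax := Ax) (c := false) (G := T.rels) (Γ := T.left)
        (Δ := T.right) z₁ A B (σ 0) (σ 1) (hσ.ne (by decide))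
        (by rw [Finset.insert_eq_of_mem hm₁]; exact hfresh 0)
        (by rw [Finset.insert_eq_of_mem hm₁]; exact hfresh 1)
        ((ihB (.var (σ 1)) ⟨_, insert (LFormula.mk (.var (σ 0)) A) T.left,
            insert (LFormula.mk (.var (σ 1)) B) T.right⟩).2 ⟨_, by simp, .refl _⟩ _ le_rfl
          (hF _ ⟨hsub, Finset.subset_insert _ _, Finset.subset_insert _ _⟩ _ _ hrel
            ((ihA _ _).1 ⟨_, by simp, .refl _⟩)))
      rwa [Finset.insert_eq_of_mem hm₁] at d

/-! ### Soundness -/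

/-- The sequent `S` satisfies `G ; Γ` and refutes `Δ`, where the labels are interpreted
by `ρ`. -/
structure Models (Ax : Set FrameAxiom) (ρ : V → Label V) (G : Finset (RelAtom (Label V)))
    (Γ Δ : Finset (LFormula V P)) (S : Sequent V P) : Prop where
  rels : ∀ r ∈ G, Holds S.rels (r.subst ρ)
  left : ∀ F ∈ Γ, Forces Ax F.formula (F.label.subst ρ) S
  right : ∀ F ∈ Δ, Refutes Ax F.formula (F.label.subst ρ) S

/-- Every sequent in which `G ; Γ ⊢ Δ` fails is cut-free derivable. -/
def Valid (Ax : Set FrameAxiom) (G : Finset (RelAtom (Label V)))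
    (Γ Δ : Finset (LFormula V P)) : Prop :=
  ∀ (ρ : V → Label V) (S : Sequent V P), Models Ax ρ G Γ Δ S → S.Provable Ax

section Models

variable {Ax : Set FrameAxiom} {ρ : V → Label V} {G : Finset (RelAtom (Label V))}
  {Γ Δ : Finset (LFormula V P)} {S T : Sequent V P} {w : Label V} {A : Formula P}

theorem Models.mono (h : S ≤ T) (hS : Models Ax ρ G Γ Δ S) : Models Ax ρ G Γ Δ T :=
  ⟨fun r hr => (hS.rels r hr).mono h.1, fun F hF => (hS.left F hF).mono h,
    fun F hF => (hS.right F hF).mono h⟩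

theorem Models.anti {G' : Finset (RelAtom (Label V))} {Γ' Δ' : Finset (LFormula V P)}
    (hG : G' ⊆ G) (hΓ : Γ' ⊆ Γ) (hΔ : Δ' ⊆ Δ) (hS : Models Ax ρ G Γ Δ S) :
    Models Ax ρ G' Γ' Δ' S :=
  ⟨fun r hr => hS.rels r (hG hr), fun F hF => hS.left F (hΓ hF),
    fun F hF => hS.right F (hΔ hF)⟩

theorem Models.insert_rel {r : RelAtom (Label V)} (hr : Holds S.rels (r.subst ρ))
    (hS : Models Ax ρ G Γ Δ S) : Models Ax ρ (insert r G) Γ Δ S :=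
  ⟨fun r' hr' => (Finset.mem_insert.1 hr').elim (fun h => h ▸ hr) (hS.rels r'),
    hS.left, hS.right⟩

theorem Models.insert_left (hA : Forces Ax A (w.subst ρ) S) (hS : Models Ax ρ G Γ Δ S) :
    Models Ax ρ G (insert ⟨w, A⟩ Γ) Δ S :=
  ⟨hS.rels, fun F hF => (Finset.mem_insert.1 hF).elim (fun h => h ▸ hA) (hS.left F), hS.right⟩

theorem Models.insert_right (hA : Refutes Ax A (w.subst ρ) S) (hS : Models Ax ρ G Γ Δ S) :
    Models Ax ρ G Γ (insert ⟨w, A⟩ Δ) S :=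
  ⟨hS.rels, hS.left, fun F hF => (Finset.mem_insert.1 hF).elim (fun h => h ▸ hA) (hS.right F)⟩

theorem Models.forces (hS : Models Ax ρ G (insert ⟨w, A⟩ Γ) Δ S) :
    Forces Ax A (w.subst ρ) S :=
  hS.left _ (Finset.mem_insert_self _ _)

theorem Models.refutes (hS : Models Ax ρ G Γ (insert ⟨w, A⟩ Δ) S) :
    Refutes Ax A (w.subst ρ) S :=
  hS.right _ (Finset.mem_insert_self _ _)

theorem Models.of_insert_left (hS : Models Ax ρ G (insert ⟨w, A⟩ Γ) Δ S) :
    Models Ax ρ G Γ Δ S :=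
  hS.anti subset_rfl (Finset.subset_insert _ _) subset_rfl

theorem Models.of_insert_right (hS : Models Ax ρ G Γ (insert ⟨w, A⟩ Δ) S) :
    Models Ax ρ G Γ Δ S :=
  hS.anti subset_rfl subset_rfl (Finset.subset_insert _ _)

/-- This is how eigenvariable conditions enter soundness: a valuation may be changed freely at fresh
variables. -/
theorem Models.congr {ρ' : V → Label V} (h : ∀ v, ρ v = ρ' v ∨ Fresh v G Γ Δ)
    (hS : Models Ax ρ G Γ Δ S) : Models Ax ρ' G Γ Δ S := by
  refine ⟨fun r hr => ?_, fun F hF => ?_, fun F hF => ?_⟩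
  · rw [← RelAtom.subst_congr fun v hv => (h v).resolve_right fun hf => hf.1 r hr hv]
    exact hS.rels r hr
  · rw [← Label.subst_congr fun v hv => (h v).resolve_right fun hf => hf.2.1 F hF hv]
    exact hS.left F hF
  · rw [← Label.subst_congr fun v hv => (h v).resolve_right fun hf => hf.2.2 F hF hv]
    exact hS.right F hF

/-- A formula valid relative to a context is forced in every model of the context. -/
theorem Valid.forces (h : Valid Ax G Γ (insert ⟨w, A⟩ Δ)) (hS : Models Ax ρ G Γ Δ S) :
    Forces Ax A (w.subst ρ) S :=
  .of_refutes fun T hT hR => h ρ T ((hS.mono hT).insert_right hR)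

/-- A formula refutable relative to a context is refuted in every model of the context. -/
theorem Valid.refutes (h : Valid Ax G (insert ⟨w, A⟩ Γ) Δ) (hS : Models Ax ρ G Γ Δ S) :
    Refutes Ax A (w.subst ρ) S :=
  fun T hT hF => h ρ T ((hS.mono hT).insert_left hF)

/-- The first premise makes the cut formula forced and the second makes it refuted at the same
world, so no induction on the formula or on derivations occurs. -/
theorem Valid.cut {G' : Finset (RelAtom (Label V))} {Γ' Δ' : Finset (LFormula V P)}
    (h₁ : Valid Ax G Γ (insert ⟨w, A⟩ Δ)) (h₂ : Valid Ax G' (insert ⟨w, A⟩ Γ') Δ') :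
    Valid Ax (G ∪ G') (Γ ∪ Γ') (Δ ∪ Δ') := fun _ S hS =>
  h₂.refutes
    (hS.anti Finset.subset_union_right Finset.subset_union_right Finset.subset_union_right)
    S le_rfl
    (h₁.forces
      (hS.anti Finset.subset_union_left Finset.subset_union_left Finset.subset_union_left))

theorem Valid.frame [Infinite V] (F : FrameAxiom) (hF : F ∈ Ax) (θ : Fin F.m → Label V)
    (σ : Fin F.n → V) (hσ : Function.Injective σ) (hσ_fresh : ∀ j, Fresh (σ j) G Γ Δ)
    (hσ_ne : ∀ j i, θ i ≠ Label.var (σ j))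
    (heqs : ∀ e ∈ F.eqs, EqJudg G (e.1.subst θ) (e.2.subst θ))
    (hhyps : ∀ S ∈ F.hyps, S.subst θ ∈ G)
    (h : Valid Ax
      (G ∪ (F.concls.map (RelAtom.subst (Sum.elim θ (fun j => Label.var (σ j))))).toFinset)
      Γ Δ) :
    Valid Ax G Γ Δ := by
  classical
  intro ρ S hS
  -- Inequalities may contain `ε`, so re-instantiating variables cannot always match them; they are
  -- made literal first.
  refine Sequent.provable_of_neq (F.hyps.map fun r => (r.subst θ).subst ρ) S ?_ ?_
  · intro r hr
    obtain ⟨r', hr', rfl⟩ := List.mem_map.1 hr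
    exact hS.rels _ (hhyps r' hr')
  intro T hST hneq
  replace hS := hS.mono hST
  obtain ⟨θ', hθ', hmem⟩ := exists_subst_mem (G := T.rels)
    (θ := fun i => (θ i).subst ρ) F.hyps F.hyps_linear F.hyps_rel_ne_eps (by
      intro r hr
      have hr' := hS.rels _ (hhyps r hr)
      rw [RelAtom.subst_subst] at hr'
      cases r with
      | eq a b => exact absurd hr (F.hyps_not_eq a b)
      | neq a b => exact .inl (hneq _ _ (List.mem_map.2 ⟨_, hr, RelAtom.subst_subst _ _ _⟩))
      | rel a b c => exact .inr ⟨a, b, c, rfl, hr'⟩)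
  -- The variables `σ j` are fresh for the derived sequent but not for the world `T`, so the rule is
  -- applied to `T` with new eigenvariables `τ j`.
  obtain ⟨τ, hτ, hτ_fresh, hτ_ne⟩ := T.exists_fresh (Finset.univ.image θ')
  let T' : Sequent V P := ⟨T.rels ∪ (F.concls.map (RelAtom.subst
    (Sum.elim θ' (fun j : Fin F.n => Label.var (τ j))))).toFinset, T.left, T.right⟩
  have hTT' : T ≤ T' := ⟨Finset.subset_union_left, subset_rfl, subset_rfl⟩
  refine Derivable.frame F hF θ' (fun j => τ j) (hτ.comp Fin.val_injective)
    (fun j => hτ_fresh j) (fun j i => hτ_ne j _ (Finset.mem_image_of_mem _ (Finset.mem_univ i)))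
    (fun e he => ?_) hmem (show T'.Provable Ax from ?_)
  · have h' := EqJudg.subst hS.rels (heqs e he)
    rw [Label.subst_subst, Label.subst_subst] at h'
    exact (Label.subst_eqJudg hθ' _).symm.trans (h'.trans (Label.subst_eqJudg hθ' _))
  -- The old eigenvariables are interpreted by the new ones; injectivity of `σ` makes the choice
  -- unambiguous.
  let ρ' : V → Label V := fun v => if hv : ∃ j, σ j = v then .var (τ hv.choose) else ρ v
  have hρ'σ : ∀ j, ρ' (σ j) = .var (τ j) := by
    intro j
    have hv : ∃ j', σ j' = σ j := ⟨j, rfl⟩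
    simp only [ρ', dif_pos hv]
    rw [hσ hv.choose_spec]
  have hρ' : ∀ v, ρ v = ρ' v ∨ ∃ j, σ j = v := by
    intro v
    by_cases hv : ∃ j, σ j = v
    · exact .inr hv
    · exact .inl (by simp only [ρ', dif_neg hv])
  have hT' : Models Ax ρ' G Γ Δ T' :=
    (hS.mono hTT').congr fun v => (hρ' v).imp_right fun ⟨j, hj⟩ => hj ▸ hσ_fresh j
  refine h ρ' T' ⟨fun r hr => ?_, hT'.left, hT'.right⟩
  rcases Finset.mem_union.1 hr with hr | hr
  · exact hT'.rels r hr
  obtain ⟨r', hr', rfl⟩ := List.mem_map.1 (List.mem_toFinset.1 hr)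
  rw [RelAtom.subst_subst]
  refine Holds.subst_congr (θ' := Sum.elim θ' (fun j : Fin F.n => Label.var (τ j))) ?_
    (Holds.of_mem (Finset.mem_union_right _ (List.mem_toFinset.2 (List.mem_map_of_mem hr'))))
  rintro (i | j)
  -- Since `θ i` need not occur in the conclusion, freshness is not enough here: the separate
  -- condition `hσ_ne` is what keeps its value unchanged.
  · have hi : (θ i).subst ρ' = (θ i).subst ρ := by
      refine (Label.subst_congr fun v hv => (hρ' v).resolve_right ?_).symm
      rintro ⟨j, rfl⟩
      refine hσ_ne j i ?_
      cases hθi : θ i with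
      | eps => simp [hθi, Label.vars] at hv
      | var u =>
        rw [hθi] at hv
        rw [List.mem_singleton.1 hv]
    simp only [Sum.elim_inl, hi]
    exact (hθ' i).mono hTT'.1
  · simp only [Sum.elim_inr, Label.subst, hρ'σ]
    exact .refl _

end Models

/-- Variables suffice because `id` is the only rule relating equal labels of one formula directly;
the other equality side conditions are absorbed by relational atoms or by the clause for `emp`. -/
theorem Forces.var_congr {Ax : Set FrameAxiom} {p : P} {w w' : Label V} {S : Sequent V P}
    (h : EqJudg S.rels w w') (hS : Forces Ax (.var p) w S) : Forces Ax (.var p) w' S :=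
  fun T hT ⟨u, hu, hwu⟩ => hS T hT ⟨u, hu, (h.mono hT.1).trans hwu⟩

/-- Every derivable sequent is valid, also if the derivation uses the cut rule. -/
theorem Derivable.valid [Infinite V] {Ax : Set FrameAxiom} {c : Bool}
    {G : Finset (RelAtom (Label V))} {Γ Δ : Finset (LFormula V P)}
    (d : Derivable Ax c G Γ Δ) : Valid Ax G Γ Δ := by
  classical
  induction d with
  | id w w' p h =>
    exact fun ρ S hS => hS.refutes S le_rfl (hS.forces.var_congr (EqJudg.subst hS.rels h))
  | botL w => exact fun ρ S hS => hS.forces S le_rfl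
  | topR w => exact fun ρ S hS => hS.refutes S le_rfl trivial
  | empL w d ih =>
    exact fun ρ S hS => hS.forces S le_rfl fun T hT hw =>
      ih ρ T ((hS.of_insert_left.mono hT).insert_rel hw)
  | empR w h =>
    exact fun ρ S hS => hS.refutes S le_rfl (.of fun T hT =>
      (EqJudg.subst hS.rels h).mono hT.1)
  | andL w A B d ih =>
    exact fun ρ S hS => ih ρ S
      ((hS.of_insert_left.insert_left hS.forces.2).insert_left hS.forces.1)
  | andR w A B d₁ d₂ ih₁ ih₂ =>
    exact fun ρ S hS => hS.refutes S le_rfl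
      ⟨ih₁.forces hS.of_insert_right, ih₂.forces hS.of_insert_right⟩
  | impL w A B d₁ d₂ ih₁ ih₂ =>
    exact fun ρ S hS => ih₂.refutes hS.of_insert_left S le_rfl
      (hS.forces S le_rfl (ih₁.forces hS.of_insert_left))
  | impR w A B d ih =>
    exact fun ρ S hS => hS.refutes S le_rfl fun T hT hA =>
      ih.forces ((hS.of_insert_right.mono hT).insert_left hA)
  | @starL G Γ Δ z A B x y hxy hx hy d ih =>
    refine fun ρ S hS => hS.forces S le_rfl ?_
    rintro T hT ⟨a, b, hr, hA, hB⟩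
    -- The eigenvariables are interpreted by the labels `a` and `b` that witness the forcing of the
    -- separating conjunction at `T`.
    let ρ' := Function.update (Function.update ρ x a) y b
    have hρx : (Label.var x).subst ρ' = a := by simp [ρ', Label.subst, hxy]
    have hρy : (Label.var y).subst ρ' = b := by simp [ρ', Label.subst]
    have hρz : z.subst ρ = z.subst ρ' := by
      refine Label.subst_congr fun v hv => ?_
      have hvx : v ≠ x := fun h => hx.2.1 ⟨z, .star A B⟩ (Finset.mem_insert_self _ _) (h ▸ hv)
      have hvy : v ≠ y := fun h => hy.2.1 ⟨z, .star A B⟩ (Finset.mem_insert_self _ _) (h ▸ hv)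
      simp [ρ', hvx, hvy]
    have hT' : Models Ax ρ' G (insert ⟨z, .star A B⟩ Γ) Δ T := (hS.mono hT).congr fun v => by
      by_cases hvx : v = x
      · exact .inr (hvx ▸ hx)
      by_cases hvy : v = y
      · exact .inr (hvy ▸ hy)
      exact .inl (by simp [ρ', hvx, hvy])
    refine ih ρ' T (((hT'.of_insert_left.insert_left ?_).insert_left ?_).insert_rel ?_)
    · rwa [hρy]
    · rwa [hρx]
    · rwa [RelAtom.subst, hρx, hρy, ← hρz]
  | starR x y z z' A B hr h d₁ d₂ ih₁ ih₂ =>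
    refine fun ρ S hS => hS.refutes S le_rfl (.of fun T hT => ?_)
    replace hS := hS.mono hT
    have hS' := hS.of_insert_right.insert_right hS.refutes
    exact ⟨_, _, Holds.rel_congr (hS.rels _ hr) (.refl _) (.refl _)
      (EqJudg.subst hS.rels h).symm, ih₁.forces hS', ih₂.forces hS'⟩
  | wandL x y y' z A B hr h d₁ d₂ ih₁ ih₂ =>
    exact fun ρ S hS => ih₂.refutes hS S le_rfl
      (hS.forces S le_rfl _ _ (Holds.rel_congr (hS.rels _ hr) (.refl _)
        (EqJudg.subst hS.rels h).symm (.refl _)) (ih₁.forces hS))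
  | @wandR G Γ Δ z A B x y hxy hx hy d ih =>
    refine fun ρ S hS => hS.refutes S le_rfl fun T hT a b hr hA => ?_
    let ρ' := Function.update (Function.update ρ x a) y b
    have hρx : (Label.var x).subst ρ' = a := by simp [ρ', Label.subst, hxy]
    have hρy : (Label.var y).subst ρ' = b := by simp [ρ', Label.subst]
    have hρz : z.subst ρ = z.subst ρ' := by
      refine Label.subst_congr fun v hv => ?_
      have hvx : v ≠ x := fun h => hx.2.2 ⟨z, .wand A B⟩ (Finset.mem_insert_self _ _) (h ▸ hv)
      have hvy : v ≠ y := fun h => hy.2.2 ⟨z, .wand A B⟩ (Finset.mem_insert_self _ _) (h ▸ hv)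
      simp [ρ', hvx, hvy]
    have hT' : Models Ax ρ' G Γ (insert ⟨z, .wand A B⟩ Δ) T := (hS.mono hT).congr fun v => by
      by_cases hvx : v = x
      · exact .inr (hvx ▸ hx)
      by_cases hvy : v = y
      · exact .inr (hvy ▸ hy)
      exact .inl (by simp [ρ', hvx, hvy])
    rw [← hρy]
    refine ih.forces ((hT'.of_insert_right.insert_left ?_).insert_rel ?_)
    · rwa [hρx]
    · rwa [RelAtom.subst, hρx, hρy, ← hρz]
  | nEq x y hr h =>
    intro ρ S hS
    obtain ⟨a, b, hm, ha, hb⟩ := hS.rels _ hr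
    exact .nEq a b hm (ha.symm.trans ((EqJudg.subst hS.rels h).trans hb))
  -- `EM` is applied to the world itself, at the values of the two labels; each branch is again a
  -- model of the corresponding premise.
  | em x y d₁ d₂ ih₁ ih₂ =>
    intro ρ S hS
    have hle : ∀ r, S ≤ ⟨insert r S.rels, S.left, S.right⟩ :=
      fun r => ⟨Finset.subset_insert _ _, subset_rfl, subset_rfl⟩
    exact .em (x.subst ρ) (y.subst ρ)
      (ih₁ ρ _ ((hS.mono (hle (.eq (x.subst ρ) (y.subst ρ)))).insert_rel
        (Holds.of_mem (Finset.mem_insert_self _ _))))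
      (ih₂ ρ _ ((hS.mono (hle (.neq (x.subst ρ) (y.subst ρ)))).insert_rel
        (Holds.of_mem (Finset.mem_insert_self _ _))))
  | frame F hF θ σ hσ hσ_fresh hσ_ne heqs hhyps d ih =>
    exact Valid.frame F hF θ σ hσ hσ_fresh hσ_ne heqs hhyps ih
  | cut hc w A d₁ d₂ ih₁ ih₂ => exact ih₁.cut ih₂

/-- Every valid sequent has a cut-free derivation. -/
theorem Valid.derivable [Infinite V] {Ax : Set FrameAxiom} {G : Finset (RelAtom (Label V))}
    {Γ Δ : Finset (LFormula V P)} (h : Valid Ax G Γ Δ) : Derivable Ax false G Γ Δ := by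
  -- The sequent is taken as its own countermodel, under the identity valuation.
  refine h Label.var ⟨G, Γ, Δ⟩ ⟨fun r hr => ?_, fun F hF => ?_, fun F hF => ?_⟩
  · rw [RelAtom.subst_var]
    exact Holds.of_mem hr
  · rw [Label.subst_var]
    exact (forces_and_refutes _ _ _).1 ⟨_, hF, .refl _⟩
  · rw [Label.subst_var]
    exact (forces_and_refutes _ _ _).2 ⟨_, hF, .refl _⟩

end LSG

theorem mainTheorem6 {V P : Type*} [Infinite V] (Ax : Set LSG.FrameAxiom) :
    (∀ (G G' : Finset (LSG.RelAtom (LSG.Label V))) (Γ Γ' Δ Δ' : Finset (LSG.LFormula V P))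
        (w : LSG.Label V) (A : LSG.Formula P),
      LSG.Derivable Ax false G Γ (insert ⟨w, A⟩ Δ) →
      LSG.Derivable Ax false G' (insert ⟨w, A⟩ Γ') Δ' →
      LSG.Derivable Ax false (G ∪ G') (Γ ∪ Γ') (Δ ∪ Δ')) ∧
    (∀ (G : Finset (LSG.RelAtom (LSG.Label V))) (Γ Δ : Finset (LSG.LFormula V P)),
      LSG.Derivable Ax true G Γ Δ → LSG.Derivable Ax false G Γ Δ) :=
  ⟨fun _ _ _ _ _ _ _ _ d₁ d₂ => (d₁.valid.cut d₂.valid).derivable,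
    fun _ _ _ d => d.valid.derivable⟩
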